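/- Let $k$ be a field of characteristic zero. For $w=(w_1,w_2)\in(\mathbb{Z}_{\ge 0})^2$ and a nonzero polynomial $f\in k[x_1,x_2]$, let $\deg_w f$ be the maximum of $a_1w_1+a_2w_2$ over the monomials $x_1^{a_1}x_2^{a_2}$ occurring in $f$ with nonzero coefficient, and let $f^w$ be the sum of those terms of $f$ whose monomials attain this maximum. Let $f_1,f_2\in k[x_1,x_2]$ satisfy $k[f_1,f_2]=k[x_1,x_2]$, let $w=(w_1,w_2)\in(\mathbb{Z}_{\ge 0})^2$, and suppose that $f_1^w$ and $f_2^w$ are algebraically dependent over $k$. Then $\deg_w f_1$ and $\deg_w f_2$ are positive integers which satisfy $$\deg_w f_1+\deg_w f_2\ \ge\ \operatorname{lcm}(\deg_w f_1,\deg_w f_2)+\min\{w_1,w_2\}.$$ In particular, $\deg_w f_1$ divides $\deg_w f_2$ or $\deg_w f_2$ divides $\deg_w f_1$. -/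

import Mathlib

open MvPolynomial

noncomputable section

/-- For a weight vector `w`, the initial form `f ^ w` of `f`: the sum of the terms of `f` whose
`w`-degree `∑ i, a i * w i` equals the `w`-degree `weightedTotalDegree w f` of `f`.
(For `f = 0` this gives `0`.) -/
def initialForm {k : Type*} [Field k] {σ : Type*} (w : σ → ℕ) (f : MvPolynomial σ k) :
    MvPolynomial σ k :=
  weightedHomogeneousComponent w (weightedTotalDegree w f) f

end

/-! Write d₁, d₂ for the degrees and g₁, g₂ for the initial forms. The Jacobian of f₁, f₂ is a
nonzero constant c, so T = c⁻¹ f₂ J(f₁, ·) is a derivation with T f₁ = 0 and T f₂ = f₂: it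
multiplies f₁^a f₂^b by b, and it raises the w-degree by at most d₁ + d₂ - w₁ - w₂. Let q = P(f₁,
f₂) with P ≠ 0 of degree e for the weights (d₁, d₂). The degree-e component of T^m q is the sum of
the top terms of P at (g₁, g₂), each multiplied by b^m. By Vandermonde it cannot vanish for every m
below the number of top terms, and that number is at most e / lcm(d₁, d₂) + 1. So some m satisfies m
lcm(d₁, d₂) ≤ e ≤ deg q + m(d₁ + d₂ - w₁ - w₂); this is `exists_degree_bound`.

If the inequality failed, q = x_i would force m = 0, so x_i would be its own degree-e component and
lie in k[g₁, g₂]. Then g₁, g₂ generate the polynomial ring, hence are independent, because a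
surjective endomorphism of a Noetherian ring is injective. If d₁ or d₂ is zero, the initial forms
generate as well. -/

open Finsupp (weight single)

/-! ### Weighted degrees and top components -/

section WeightedDegree

variable {k σ : Type*} [Field k]

theorem weightedTotalDegree_le_iff {w : σ → ℕ} {f : MvPolynomial σ k} {n : ℕ} :
    weightedTotalDegree w f ≤ n ↔ ∀ s, coeff s f ≠ 0 → weight w s ≤ n := by
  simp [weightedTotalDegree, Finset.sup_le_iff, mem_support_iff]

theorem weight_le_weightedTotalDegree (w : σ → ℕ) {f : MvPolynomial σ k} {s : σ →₀ ℕ}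
    (h : coeff s f ≠ 0) : weight w s ≤ weightedTotalDegree w f :=
  le_weightedTotalDegree w (mem_support_iff.2 h)

theorem exists_coeff_ne_zero_weight_eq (w : σ → ℕ) {f : MvPolynomial σ k} (hf : f ≠ 0) :
    ∃ s, coeff s f ≠ 0 ∧ weight w s = weightedTotalDegree w f := by
  obtain ⟨s, hs, h⟩ := Finset.exists_mem_eq_sup f.support (support_nonempty.2 hf)
    (fun s => weight w s)
  exact ⟨s, mem_support_iff.1 hs, h.symm⟩

theorem initialForm_ne_zero (w : σ → ℕ) {f : MvPolynomial σ k} (hf : f ≠ 0) :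
    initialForm w f ≠ 0 := by
  obtain ⟨s, hs, h⟩ := exists_coeff_ne_zero_weight_eq w hf
  intro h0
  apply hs
  have := congrArg (coeff s) h0
  simpa [initialForm, coeff_weightedHomogeneousComponent, h] using this

theorem exists_coeff_ne_zero_of_mul {p q : MvPolynomial σ k} {s : σ →₀ ℕ}
    (h : coeff s (p * q) ≠ 0) : ∃ a b, coeff a p ≠ 0 ∧ coeff b q ≠ 0 ∧ a + b = s := by
  classical
  rw [coeff_mul] at h
  obtain ⟨⟨a, b⟩, hab, hne⟩ := Finset.exists_ne_zero_of_sum_ne_zero h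
  exact ⟨a, b, left_ne_zero_of_mul hne, right_ne_zero_of_mul hne,
    Finset.HasAntidiagonal.mem_antidiagonal.1 hab⟩

theorem weightedTotalDegree_mul_le (w : σ → ℕ) (p q : MvPolynomial σ k) :
    weightedTotalDegree w (p * q) ≤ weightedTotalDegree w p + weightedTotalDegree w q := by
  rw [weightedTotalDegree_le_iff]
  intro s hs
  obtain ⟨a, b, ha, hb, rfl⟩ := exists_coeff_ne_zero_of_mul hs
  rw [map_add]
  exact add_le_add (weight_le_weightedTotalDegree w ha) (weight_le_weightedTotalDegree w hb)

theorem weightedHomogeneousComponent_mul_of_le {w : σ → ℕ} {p q : MvPolynomial σ k} {m n : ℕ}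
    (hp : weightedTotalDegree w p ≤ m) (hq : weightedTotalDegree w q ≤ n) :
    weightedHomogeneousComponent w (m + n) (p * q) =
      weightedHomogeneousComponent w m p * weightedHomogeneousComponent w n q := by
  classical
  rw [weightedTotalDegree_le_iff] at hp hq
  ext s
  simp only [coeff_weightedHomogeneousComponent, coeff_mul]
  split_ifs with hs
  · refine Finset.sum_congr rfl fun ⟨a, b⟩ hab => ?_
    have hab := Finset.HasAntidiagonal.mem_antidiagonal.1 hab
    simp only at hab ⊢
    rw [← hab, map_add] at hs
    by_cases ha : coeff a p = 0
    · simp [ha]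
    by_cases hb : coeff b q = 0
    · simp [hb]
    have h1 := hp a ha
    have h2 := hq b hb
    rw [if_pos (by omega), if_pos (by omega)]
  · refine (Finset.sum_eq_zero fun ⟨a, b⟩ hab => ?_).symm
    have hab := Finset.HasAntidiagonal.mem_antidiagonal.1 hab
    simp only at hab ⊢
    rw [← hab, map_add] at hs
    by_cases ha : weight w a = m
    · rw [if_neg (show ¬ weight w b = n by omega), mul_zero]
    · rw [if_neg ha, zero_mul]

theorem weightedTotalDegree_pow_le {w : σ → ℕ} {p : MvPolynomial σ k} {m : ℕ}
    (hp : weightedTotalDegree w p ≤ m) (n : ℕ) : weightedTotalDegree w (p ^ n) ≤ n * m := by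
  induction n with
  | zero =>
    rw [pow_zero, weightedTotalDegree_le_iff]
    intro s hs
    classical
    rw [coeff_one] at hs
    obtain rfl : 0 = s := by by_contra h; simp [h] at hs
    simp
  | succ n ih =>
    rw [pow_succ, add_mul, one_mul]
    exact (weightedTotalDegree_mul_le w _ _).trans (add_le_add ih hp)

theorem weightedHomogeneousComponent_pow_of_le {w : σ → ℕ} {p : MvPolynomial σ k} {m : ℕ}
    (hp : weightedTotalDegree w p ≤ m) (n : ℕ) :
    weightedHomogeneousComponent w (n * m) (p ^ n) = weightedHomogeneousComponent w m p ^ n := by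
  induction n with
  | zero =>
    rw [pow_zero, pow_zero, zero_mul]
    exact (isWeightedHomogeneous_one k w).weightedHomogeneousComponent_same
  | succ n ih =>
    rw [pow_succ, pow_succ, add_mul, one_mul,
      weightedHomogeneousComponent_mul_of_le (weightedTotalDegree_pow_le hp n) hp, ih]

theorem coeff_add_single_ne_zero_of_pderiv {i : σ} {p : MvPolynomial σ k} {s : σ →₀ ℕ}
    (h : coeff s (pderiv i p) ≠ 0) : coeff (s + single i 1) p ≠ 0 := by
  rw [coeff_pderiv] at h
  exact left_ne_zero_of_mul h

theorem weight_fin_two (v : Fin 2 → ℕ) (s : Fin 2 →₀ ℕ) : weight v s = s 0 * v 0 + s 1 * v 1 := by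
  simp [Finsupp.weight_apply, Finsupp.sum_fintype]

end WeightedDegree

/-! ### Vandermonde, monomial counting, Noetherian endomorphisms -/

/-- If the `b s` are distinct and the `u s` nonzero, then not all sums of `u s * b s ^ m` with
`m` less than the number of terms vanish. -/
theorem exists_sum_mul_pow_ne_zero {ι A : Type*} [CommRing A] [IsDomain A] [CharZero A]
    (S : Finset ι) (hS : S.Nonempty) (b : ι → ℕ) (hb : Set.InjOn b S) (u : ι → A)
    (hu : ∀ s ∈ S, u s ≠ 0) : ∃ m < S.card, ∑ s ∈ S, u s * (b s : A) ^ m ≠ 0 := by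
  by_contra! h
  let e := S.equivFin.symm
  have key := Matrix.eq_zero_of_forall_pow_sum_mul_pow_eq_zero
    (f := fun j => ((b (e j) : ℕ) : A)) (v := fun j => u (e j)) ?_ ?_
  · obtain ⟨s, hs⟩ := hS
    apply hu s hs
    simpa [e] using congrFun key (S.equivFin ⟨s, hs⟩)
  · intro i j hij
    have : b (e i) = b (e j) := Nat.cast_injective (R := A) hij
    exact e.injective (Subtype.ext (hb (e i).2 (e j).2 this))
  · intro i
    rw [← h i i.2, ← Finset.sum_coe_sort S]
    exact e.sum_comp (fun s => u s * (b s : A) ^ (i : ℕ))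

/-- A bound for the number of monomials of weighted degree `e` in two variables of positive
weights. -/
theorem card_le_of_weight_eq {v : Fin 2 → ℕ} (h0 : 0 < v 0) (h1 : 0 < v 1) {e : ℕ}
    (S : Finset (Fin 2 →₀ ℕ)) (hS : ∀ s ∈ S, weight v s = e) :
    (S.card - 1) * (v 0).lcm (v 1) ≤ e := by
  have hl : 0 < (v 0).lcm (v 1) := Nat.lcm_pos h0 h1
  -- As the weight is fixed, `s 1 * v 1` is determined modulo `v 0`, and it is 0 modulo `v 1`; so
  -- its quotient by the lcm determines it.
  have hinj : Set.InjOn (fun s : Fin 2 →₀ ℕ => s 1 * v 1 / (v 0).lcm (v 1)) S := by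
    intro s hs t ht hst
    have hs' := hS s hs
    have ht' := hS t ht
    rw [weight_fin_two] at hs' ht'
    have hmod0 : s 1 * v 1 ≡ t 1 * v 1 [MOD v 0] := by
      have : s 0 * v 0 + s 1 * v 1 ≡ t 0 * v 0 + t 1 * v 1 [MOD v 0] := by rw [hs', ht']
      simpa [Nat.ModEq, Nat.mul_add_mod'] using this
    have hmod1 : s 1 * v 1 ≡ t 1 * v 1 [MOD v 1] := by simp [Nat.ModEq]
    have hmod : s 1 * v 1 ≡ t 1 * v 1 [MOD (v 0).lcm (v 1)] := by
      rw [Nat.modEq_iff_dvd] at *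
      exact_mod_cast Int.coe_lcm_dvd hmod0 hmod1
    have h : s 1 * v 1 = t 1 * v 1 := by
      rw [← Nat.div_add_mod (s 1 * v 1) ((v 0).lcm (v 1)),
        ← Nat.div_add_mod (t 1 * v 1) ((v 0).lcm (v 1)), hmod]
      simp only at hst
      rw [hst]
    have e1 : s 1 = t 1 := Nat.eq_of_mul_eq_mul_right h1 h
    have e0 : s 0 = t 0 := Nat.eq_of_mul_eq_mul_right h0 (by omega)
    ext i
    fin_cases i <;> assumption
  have hcard : S.card ≤ e / (v 0).lcm (v 1) + 1 := by
    rw [← Finset.card_range (e / (v 0).lcm (v 1) + 1)]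
    refine Finset.card_le_card_of_injOn _ (fun s hs => ?_) hinj
    have := hS s hs
    rw [weight_fin_two] at this
    simp only [Finset.coe_range, Set.mem_Iio]
    exact Nat.lt_succ_of_le (Nat.div_le_div_right (this ▸ Nat.le_add_left _ _))
  exact (Nat.mul_le_mul_right _ (Nat.sub_le_of_le_add hcard)).trans (Nat.div_mul_le_self e _)

/-- The kernels of the powers of `φ` stabilize, say at `n`; a kernel element has the form `φ ^ n y`,
and then `y` is already killed by `φ ^ n`. -/
theorem injective_of_surjective_of_isNoetherianRing {k A : Type*} [CommRing k] [CommRing A]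
    [Algebra k A] [IsNoetherianRing A] (φ : A →ₐ[k] A) (hφ : Function.Surjective φ) :
    Function.Injective φ := by
  let K : ℕ →o Ideal A := ⟨fun n => RingHom.ker (φ ^ n), monotone_nat_of_le_succ fun n x hx => by
    rw [RingHom.mem_ker] at hx ⊢
    rw [pow_succ', AlgHom.mul_apply, hx, map_zero]⟩
  obtain ⟨n, hn⟩ := monotone_stabilizes_iff_noetherian.2 ‹IsNoetherianRing A› K
  rw [injective_iff_map_eq_zero]
  intro x hx
  obtain ⟨y, rfl⟩ : ∃ y, (φ ^ n) y = x := by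
    rw [AlgHom.coe_pow]
    exact hφ.iterate n x
  have hy : y ∈ K (n + 1) := by
    rw [← AlgHom.mul_apply, ← pow_succ'] at hx
    exact hx
  rw [← hn (n + 1) n.le_succ] at hy
  exact hy

/-! ### The Jacobian of a generating pair -/

section Jacobian

variable {k : Type*} [Field k]

/-- The derivation sending `q` to the Jacobian determinant of `(p, q)`. -/
noncomputable def jacobianDerivation (p : MvPolynomial (Fin 2) k) :
    Derivation k (MvPolynomial (Fin 2) k) (MvPolynomial (Fin 2) k) :=
  pderiv 0 p • pderiv 1 - pderiv 1 p • pderiv 0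

theorem jacobianDerivation_apply (p q : MvPolynomial (Fin 2) k) :
    jacobianDerivation p q = pderiv 0 p * pderiv 1 q - pderiv 1 p * pderiv 0 q := rfl

theorem weightedTotalDegree_jacobianDerivation_le (w : Fin 2 → ℕ) (p q : MvPolynomial (Fin 2) k)
    (h : jacobianDerivation p q ≠ 0) :
    weightedTotalDegree w (jacobianDerivation p q) + (w 0 + w 1) ≤
      weightedTotalDegree w p + weightedTotalDegree w q := by
  obtain ⟨s, hs, hw⟩ := exists_coeff_ne_zero_weight_eq w h
  rw [← hw]
  have key : ∀ i j : Fin 2, w i + w j = w 0 + w 1 → coeff s (pderiv i p * pderiv j q) ≠ 0 →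
      weight w s + (w 0 + w 1) ≤ weightedTotalDegree w p + weightedTotalDegree w q := by
    intro i j hij hne
    obtain ⟨a, b, ha, hb, rfl⟩ := exists_coeff_ne_zero_of_mul hne
    have h1 := weight_le_weightedTotalDegree w (coeff_add_single_ne_zero_of_pderiv ha)
    have h2 := weight_le_weightedTotalDegree w (coeff_add_single_ne_zero_of_pderiv hb)
    simp only [map_add, Finsupp.weight_single, one_smul] at h1 h2 ⊢
    omega
  by_cases h0 : coeff s (pderiv 0 p * pderiv 1 q) = 0
  · refine key 1 0 (add_comm _ _) fun h1 => hs ?_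
    rw [jacobianDerivation_apply, coeff_sub, h0, h1, sub_zero]
  · exact key 0 1 rfl h0

theorem derivation_aeval_fin_two {A : Type*} [CommRing A] [Algebra k A] (D : Derivation k A A)
    (f : Fin 2 → A) (P : MvPolynomial (Fin 2) k) :
    D (aeval f P) = aeval f (pderiv 0 P) * D (f 0) + aeval f (pderiv 1 P) * D (f 1) := by
  induction P using MvPolynomial.induction_on with
  | C a => simp
  | add p q hp hq => simp only [map_add, hp, hq]; ring
  | mul_X p i hp =>
    simp only [map_mul, Derivation.leibniz, hp, aeval_X, smul_eq_mul, map_add, pderiv_X]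
    fin_cases i <;> simp <;> ring

theorem exists_aeval_eq_of_adjoin_eq_top {f₁ f₂ : MvPolynomial (Fin 2) k}
    (hgen : Algebra.adjoin k {f₁, f₂} = (⊤ : Subalgebra k (MvPolynomial (Fin 2) k)))
    (q : MvPolynomial (Fin 2) k) : ∃ P : MvPolynomial (Fin 2) k, aeval ![f₁, f₂] P = q := by
  have hr : Set.range ![f₁, f₂] = {f₁, f₂} := by simp [Matrix.range_cons, Set.pair_comm]
  rw [← hr, Algebra.adjoin_range_eq_range_aeval] at hgen
  exact (AlgHom.range_eq_top _).1 hgen q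

theorem algebraicIndependent_of_adjoin_eq_top {f₁ f₂ : MvPolynomial (Fin 2) k}
    (hgen : Algebra.adjoin k {f₁, f₂} = (⊤ : Subalgebra k (MvPolynomial (Fin 2) k))) :
    AlgebraicIndependent k ![f₁, f₂] := by
  refine injective_of_surjective_of_isNoetherianRing (aeval ![f₁, f₂]) ?_
  exact exists_aeval_eq_of_adjoin_eq_top hgen

theorem jacobianDerivation_eq_C {f₁ f₂ : MvPolynomial (Fin 2) k}
    (hgen : Algebra.adjoin k {f₁, f₂} = (⊤ : Subalgebra k (MvPolynomial (Fin 2) k))) :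
    ∃ c : k, c ≠ 0 ∧ jacobianDerivation f₁ f₂ = C c := by
  obtain ⟨P, hP⟩ := exists_aeval_eq_of_adjoin_eq_top hgen (X 0)
  obtain ⟨Q, hQ⟩ := exists_aeval_eq_of_adjoin_eq_top hgen (X 1)
  have e00 := derivation_aeval_fin_two (pderiv 0) ![f₁, f₂] P
  have e01 := derivation_aeval_fin_two (pderiv 1) ![f₁, f₂] P
  have e10 := derivation_aeval_fin_two (pderiv 0) ![f₁, f₂] Q
  have e11 := derivation_aeval_fin_two (pderiv 1) ![f₁, f₂] Q
  simp only [hP, hQ, pderiv_X_self, Matrix.cons_val_zero, Matrix.cons_val_one,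
    pderiv_X_of_ne (show (1 : Fin 2) ≠ 0 by decide),
    pderiv_X_of_ne (show (0 : Fin 2) ≠ 1 by decide)] at e00 e01 e10 e11
  have hu : IsUnit (jacobianDerivation f₁ f₂) := by
    -- By the chain rule, the inverse is the Jacobian of the inverse map (P, Q), evaluated at (f₁,
    -- f₂).
    refine IsUnit.of_mul_eq_one (aeval ![f₁, f₂] (pderiv 0 P) * aeval ![f₁, f₂] (pderiv 1 Q) -
      aeval ![f₁, f₂] (pderiv 1 P) * aeval ![f₁, f₂] (pderiv 0 Q)) ?_
    rw [jacobianDerivation_apply]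
    have h1 := congrArg₂ (· * ·) e00 e11
    have h2 := congrArg₂ (· * ·) e10 e01
    linear_combination h2 - h1
  obtain ⟨hu, hC⟩ := isUnit_iff_totalDegree_of_isReduced.1 hu
  exact ⟨_, hu.ne_zero, totalDegree_eq_zero_iff_eq_C.1 hC⟩

end Jacobian
-- The Euler-type derivation and the degree bound
section InitialForms

variable {k : Type*} [Field k]

theorem weightedHomogeneousComponent_eq_zero_of_lt {w : Fin 2 → ℕ} {p : MvPolynomial (Fin 2) k}
    {n : ℕ} (h : weightedTotalDegree w p < n) : weightedHomogeneousComponent w n p = 0 := by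
  classical
  ext s
  rw [coeff_weightedHomogeneousComponent, coeff_zero]
  split_ifs with hs
  · by_contra hne
    exact absurd (weight_le_weightedTotalDegree w hne) (by omega)
  · rfl

theorem weightedHomogeneousComponent_pow_mul_pow (w : Fin 2 → ℕ) (f₁ f₂ : MvPolynomial (Fin 2) k)
    (s : Fin 2 →₀ ℕ) {e : ℕ}
    (hs : weight ![weightedTotalDegree w f₁, weightedTotalDegree w f₂] s ≤ e) :
    weightedHomogeneousComponent w e (f₁ ^ s 0 * f₂ ^ s 1) =
      if weight ![weightedTotalDegree w f₁, weightedTotalDegree w f₂] s = e then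
        initialForm w f₁ ^ s 0 * initialForm w f₂ ^ s 1 else 0 := by
  have hws : weight ![weightedTotalDegree w f₁, weightedTotalDegree w f₂] s =
      s 0 * weightedTotalDegree w f₁ + s 1 * weightedTotalDegree w f₂ := weight_fin_two _ s
  have h1 := weightedTotalDegree_pow_le (le_refl (weightedTotalDegree w f₁)) (s 0)
  have h2 := weightedTotalDegree_pow_le (le_refl (weightedTotalDegree w f₂)) (s 1)
  split_ifs with h
  · rw [← h, hws, weightedHomogeneousComponent_mul_of_le h1 h2,
      weightedHomogeneousComponent_pow_of_le le_rfl, weightedHomogeneousComponent_pow_of_le le_rfl]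
    rfl
  · refine weightedHomogeneousComponent_eq_zero_of_lt ?_
    exact ((weightedTotalDegree_mul_le w _ _).trans (add_le_add h1 h2)).trans_lt
      (hws ▸ lt_of_le_of_ne hs h)

/-- The products f₁^a f₂^b are eigenvectors of `T` with eigenvalue b. -/
theorem derivation_iterate_aeval {f₁ f₂ : MvPolynomial (Fin 2) k}
    (T : Derivation k (MvPolynomial (Fin 2) k) (MvPolynomial (Fin 2) k))
    (h1 : T f₁ = 0) (h2 : T f₂ = f₂) (P : MvPolynomial (Fin 2) k) (m : ℕ) :
    T^[m] (aeval ![f₁, f₂] P) =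
      ∑ s ∈ P.support, (coeff s P * (s 1 : k) ^ m) • (f₁ ^ s 0 * f₂ ^ s 1) := by
  have hT : ∀ a b : ℕ, T (f₁ ^ a * f₂ ^ b) = (b : k) • (f₁ ^ a * f₂ ^ b) := by
    intro a b
    rw [Derivation.leibniz, Derivation.leibniz_pow, Derivation.leibniz_pow, h1, h2]
    cases b with
    | zero => simp
    | succ b =>
      rw [← Nat.cast_smul_eq_nsmul k]
      simp only [smul_eq_mul, mul_zero, add_zero, Algebra.smul_def,
        map_natCast, Nat.add_sub_cancel]
      ring
  induction m with
  | zero =>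
    rw [Function.iterate_zero, id, aeval_def, eval₂_eq']
    refine Finset.sum_congr rfl fun s _ => ?_
    simp [Fin.prod_univ_two, Algebra.smul_def]
  | succ m ih =>
    rw [Function.iterate_succ_apply', ih, map_sum]
    refine Finset.sum_congr rfl fun s _ => ?_
    rw [Derivation.map_smul, hT, smul_smul, pow_succ, mul_assoc]

theorem weightedHomogeneousComponent_iterate_aeval (w : Fin 2 → ℕ)
    {f₁ f₂ : MvPolynomial (Fin 2) k}
    (T : Derivation k (MvPolynomial (Fin 2) k) (MvPolynomial (Fin 2) k))
    (h1 : T f₁ = 0) (h2 : T f₂ = f₂) (P : MvPolynomial (Fin 2) k) (m : ℕ) {v : Fin 2 → ℕ}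
    (hv : v = ![weightedTotalDegree w f₁, weightedTotalDegree w f₂]) :
    weightedHomogeneousComponent w (weightedTotalDegree v P) (T^[m] (aeval ![f₁, f₂] P)) =
      ∑ s ∈ P.support with weight v s = weightedTotalDegree v P,
        (coeff s P • (initialForm w f₁ ^ s 0 * initialForm w f₂ ^ s 1)) *
          (s 1 : MvPolynomial (Fin 2) k) ^ m := by
  subst hv
  rw [derivation_iterate_aeval T h1 h2, map_sum, Finset.sum_filter]
  refine Finset.sum_congr rfl fun s hs => ?_
  rw [map_smul, weightedHomogeneousComponent_pow_mul_pow w f₁ f₂ s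
    (le_weightedTotalDegree _ hs), smul_ite, smul_zero]
  split_ifs
  · simp only [Algebra.smul_def, map_mul, map_pow, map_natCast]
    ring
  · rfl

theorem weightedTotalDegree_iterate_le {w : Fin 2 → ℕ} {d W : ℕ}
    (T : Derivation k (MvPolynomial (Fin 2) k) (MvPolynomial (Fin 2) k))
    (hT : ∀ q, T q ≠ 0 → weightedTotalDegree w (T q) + W ≤ weightedTotalDegree w q + d)
    (q : MvPolynomial (Fin 2) k) (m : ℕ) (h : T^[m] q ≠ 0) :
    weightedTotalDegree w (T^[m] q) + m * W ≤ weightedTotalDegree w q + m * d := by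
  induction m with
  | zero => simp
  | succ m ih =>
    rw [Function.iterate_succ_apply'] at h ⊢
    have := ih fun h0 => h (by rw [h0, map_zero])
    have := hT _ h
    rw [add_mul, add_mul]
    omega

/-- A lower bound for the `w`-degree of a polynomial `P` in `f₁`, `f₂` whose Jacobian is a nonzero
constant. If `m = 0`, the leading terms of `P` do not cancel at the initial forms. -/
theorem exists_degree_bound [CharZero k] (w : Fin 2 → ℕ) {f₁ f₂ : MvPolynomial (Fin 2) k}
    (hd₁ : 0 < weightedTotalDegree w f₁) (hd₂ : 0 < weightedTotalDegree w f₂)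
    {c : k} (hc : c ≠ 0) (hJ : jacobianDerivation f₁ f₂ = C c)
    {P : MvPolynomial (Fin 2) k} (hP : P ≠ 0) {v : Fin 2 → ℕ}
    (hv : v = ![weightedTotalDegree w f₁, weightedTotalDegree w f₂]) :
    ∃ m : ℕ, m * (weightedTotalDegree w f₁).lcm (weightedTotalDegree w f₂) ≤
        weightedTotalDegree v P ∧
      weightedTotalDegree v P + m * (w 0 + w 1) ≤ weightedTotalDegree w (aeval ![f₁, f₂] P) +
        m * (weightedTotalDegree w f₁ + weightedTotalDegree w f₂) ∧
      (m = 0 → weightedHomogeneousComponent w (weightedTotalDegree v P) (aeval ![f₁, f₂] P) ≠ 0 ∧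
        weightedHomogeneousComponent w (weightedTotalDegree v P) (aeval ![f₁, f₂] P) ∈
          Algebra.adjoin k {initialForm w f₁, initialForm w f₂}) := by
  have hf₁ : f₁ ≠ 0 := by rintro rfl; simp [weightedTotalDegree_zero] at hd₁
  have hf₂ : f₂ ≠ 0 := by rintro rfl; simp [weightedTotalDegree_zero] at hd₂
  let T := (C c⁻¹ * f₂) • jacobianDerivation f₁
  have hT : ∀ q, T q = C c⁻¹ * f₂ * jacobianDerivation f₁ q := fun q => rfl
  have hT1 : T f₁ = 0 := by rw [hT, jacobianDerivation_apply]; ring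
  have hT2 : T f₂ = f₂ := by
    rw [hT, hJ, mul_right_comm, ← C_mul, inv_mul_cancel₀ hc, C_1, one_mul]
  have hdeg : ∀ q, T q ≠ 0 → weightedTotalDegree w (T q) + (w 0 + w 1) ≤
      weightedTotalDegree w q + (weightedTotalDegree w f₁ + weightedTotalDegree w f₂) := by
    intro q hq
    rw [hT] at hq ⊢
    have h1 := weightedTotalDegree_jacobianDerivation_le w f₁ q (right_ne_zero_of_mul hq)
    have h2 := weightedTotalDegree_mul_le w (C c⁻¹ * f₂) (jacobianDerivation f₁ q)
    have h3 := weightedTotalDegree_mul_le w (C c⁻¹) f₂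
    have h4 : weightedTotalDegree w (C c⁻¹ : MvPolynomial (Fin 2) k) = 0 :=
      isWeightedHomogeneous_zero_iff_weightedTotalDegree_eq_zero.1 (isWeightedHomogeneous_C w _)
    omega
  set e := weightedTotalDegree v P with he
  set S := P.support.filter fun s => weight v s = e with hS
  have hmemS : ∀ s ∈ S, coeff s P ≠ 0 ∧ weight v s = e := by
    intro s hs
    rw [hS, Finset.mem_filter, mem_support_iff] at hs
    exact hs
  have hv0 : v 0 = weightedTotalDegree w f₁ := by rw [hv]; rfl
  have hv1 : v 1 = weightedTotalDegree w f₂ := by rw [hv]; rfl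
  have hSne : S.Nonempty := by
    obtain ⟨s, hs, hse⟩ := exists_coeff_ne_zero_weight_eq v hP
    exact ⟨s, Finset.mem_filter.2 ⟨mem_support_iff.2 hs, hse⟩⟩
  -- At fixed weight the exponent of f₂ determines the monomial, so the eigenvalues are distinct.
  have hinj : Set.InjOn (fun s : Fin 2 →₀ ℕ => s 1) S := by
    intro s hs t ht hst
    have h1 := (hmemS s hs).2
    rw [← (hmemS t ht).2, weight_fin_two, weight_fin_two] at h1
    simp only at hst
    rw [hst] at h1
    have h0 : s 0 = t 0 := Nat.eq_of_mul_eq_mul_right (hv0 ▸ hd₁) (Nat.add_right_cancel h1)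
    ext i
    fin_cases i <;> assumption
  have hterm : ∀ s ∈ S,
      coeff s P • (initialForm w f₁ ^ s 0 * initialForm w f₂ ^ s 1) ≠ 0 := by
    intro s hs
    exact smul_ne_zero (hmemS s hs).1 (mul_ne_zero (pow_ne_zero _ (initialForm_ne_zero w hf₁))
      (pow_ne_zero _ (initialForm_ne_zero w hf₂)))
  obtain ⟨m, hm, hne⟩ := exists_sum_mul_pow_ne_zero S hSne _ hinj _ hterm
  rw [← weightedHomogeneousComponent_iterate_aeval w T hT1 hT2 P m hv, ← he] at hne
  have hcard := card_le_of_weight_eq (hv0 ▸ hd₁) (hv1 ▸ hd₂) S fun s hs => (hmemS s hs).2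
  rw [hv0, hv1] at hcard
  refine ⟨m, (Nat.mul_le_mul_right _ (by omega)).trans hcard, ?_, ?_⟩
  · have h1 : e ≤ weightedTotalDegree w (T^[m] (aeval ![f₁, f₂] P)) := by
      by_contra! hlt
      exact hne (weightedHomogeneousComponent_eq_zero_of_lt hlt)
    have h2 := weightedTotalDegree_iterate_le T hdeg (aeval ![f₁, f₂] P) m
      fun h0 => hne (by rw [h0, map_zero])
    omega
  · rintro rfl
    refine ⟨hne, ?_⟩
    have := weightedHomogeneousComponent_iterate_aeval w T hT1 hT2 P 0 hv
    rw [Function.iterate_zero, id] at this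
    rw [he, this]
    refine Subalgebra.sum_mem _ fun s _ => ?_
    rw [pow_zero, mul_one]
    refine Subalgebra.smul_mem _ (Subalgebra.mul_mem _ (Subalgebra.pow_mem _ ?_ _)
      (Subalgebra.pow_mem _ ?_ _)) _ <;> exact Algebra.subset_adjoin (by simp)

/-! ### The case of a generator of degree zero -/

theorem pderiv_eq_zero_of_weightedTotalDegree_eq_zero {w : Fin 2 → ℕ} {f : MvPolynomial (Fin 2) k}
    (h : weightedTotalDegree w f = 0) {i : Fin 2} (hi : w i ≠ 0) : pderiv i f = 0 := by
  ext s
  rw [coeff_zero]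
  by_contra hs
  have := weight_le_weightedTotalDegree w (coeff_add_single_ne_zero_of_pderiv hs)
  rw [h, map_add, Finsupp.weight_single, one_smul] at this
  omega

theorem eq_single_of_pderiv_eq_C [CharZero k] {f : MvPolynomial (Fin 2) k} {i : Fin 2} {c : k}
    (h : pderiv i f = C c) {s : Fin 2 →₀ ℕ} (hs : coeff s f ≠ 0) (hi : s i ≠ 0) :
    s = single i 1 := by
  have hle : single i 1 ≤ s := by rw [Finsupp.single_le_iff]; omega
  have hc := congrArg (coeff (s - single i 1)) h
  rw [coeff_pderiv, tsub_add_cancel_of_le hle, coeff_C] at hc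
  have h0 : 0 = s - single i 1 := by
    by_contra hne
    rw [if_neg hne] at hc
    exact mul_ne_zero hs (Nat.cast_add_one_ne_zero _) hc
  exact le_antisymm (tsub_eq_zero_iff_le.1 h0.symm) hle

theorem coeff_single_of_pderiv_eq_C {f : MvPolynomial (Fin 2) k} {i : Fin 2} {c : k}
    (h : pderiv i f = C c) : coeff (single i 1) f = c := by
  have hc := congrArg (coeff 0) h
  rw [coeff_pderiv, coeff_C] at hc
  simpa using hc

theorem jacobianDerivation_swap (p q : MvPolynomial (Fin 2) k) :
    jacobianDerivation q p = - jacobianDerivation p q := by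
  rw [jacobianDerivation_apply, jacobianDerivation_apply]
  ring

/-- If `p` has `w`-degree zero and the Jacobian of `p`, `q` is a nonzero constant, then the
initial forms of `p`, `q` generate the polynomial ring. -/
theorem adjoin_initialForm_eq_top_of_degree_eq_zero [CharZero k] {w : Fin 2 → ℕ}
    {p q : MvPolynomial (Fin 2) k} {i j : Fin 2} (hij : ∀ l, l = i ∨ l = j) (hne : i ≠ j)
    (hi : w i ≠ 0) (hp : weightedTotalDegree w p = 0)
    {c : k} (hc : c ≠ 0) (hJ : pderiv i p * pderiv j q - pderiv j p * pderiv i q = C c) :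
    Algebra.adjoin k {initialForm w p, initialForm w q} = ⊤ := by
  classical
  have hpi := pderiv_eq_zero_of_weightedTotalDegree_eq_zero hp hi
  rw [hpi, zero_mul, zero_sub] at hJ
  -- `p` is free of `X i`, so the Jacobian is a single product and both factors are constants. Hence
  -- `p` is affine in `X j`, and `q` is a multiple of `X i` plus terms in `X j` alone.
  have hu : IsUnit (pderiv j p * pderiv i q) := by
    rw [← IsUnit.neg_iff, hJ]
    exact (isUnit_iff_ne_zero.2 hc).map C
  have hC : ∀ {r : MvPolynomial (Fin 2) k}, IsUnit r → ∃ a : k, a ≠ 0 ∧ r = C a := fun hr =>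
    have h := isUnit_iff_totalDegree_of_isReduced.1 hr
    ⟨_, h.1.ne_zero, totalDegree_eq_zero_iff_eq_C.1 h.2⟩
  obtain ⟨a, ha, hpa⟩ := hC (isUnit_of_mul_isUnit_left hu)
  obtain ⟨b, hb, hqb⟩ := hC (isUnit_of_mul_isUnit_right hu)
  have hwj : w j = 0 := by
    by_contra hj
    rw [pderiv_eq_zero_of_weightedTotalDegree_eq_zero hp hj] at hpa
    exact ha (C_injective _ _ (by rw [← hpa, C_0]))
  have hext : ∀ s t : Fin 2 →₀ ℕ, s i = t i → s j = t j → s = t := by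
    intro s t h1 h2
    ext l
    rcases hij l with rfl | rfl <;> assumption
  have hweight : ∀ s : Fin 2 →₀ ℕ, weight w s = s i * w i := by
    intro s
    rw [show s = single i (s i) + single j (s j) from hext _ _ (by simp [hne.symm]) (by simp [hne])]
    simp [Finsupp.weight_single, hwj, hne.symm]
  have hpform : initialForm w p = C a * X j + C (coeff 0 p) := by
    ext s
    rw [initialForm, hp, coeff_weightedHomogeneousComponent, coeff_add, coeff_C_mul, coeff_X,
      coeff_C, hweight]
    by_cases hsi : s i = 0
    · by_cases hsj : s j = 0
      · obtain rfl : s = 0 := hext _ _ hsi hsj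
        simp
      · have h0 : s ≠ 0 := by rintro rfl; exact hsj rfl
        rw [if_pos (by simp [hsi]), if_neg h0.symm, add_zero]
        by_cases h1 : s = single j 1
        · rw [h1, coeff_single_of_pderiv_eq_C hpa]; simp
        · rw [if_neg (Ne.symm h1), mul_zero]
          by_contra hs
          exact h1 (eq_single_of_pderiv_eq_C hpa hs hsj)
    · have h0 : s ≠ 0 := by rintro rfl; exact hsi rfl
      have h1 : s ≠ single j 1 := by rintro rfl; simp [hne] at hsi
      rw [if_neg (mul_ne_zero hsi hi), if_neg h1.symm, if_neg h0.symm]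
      simp
  have hqi : coeff (single i 1) q ≠ 0 := by rwa [coeff_single_of_pderiv_eq_C hqb]
  have hq : weightedTotalDegree w q = w i := by
    apply le_antisymm
    · rw [weightedTotalDegree_le_iff]
      intro s hs
      by_cases hsi : s i = 0
      · simp [hweight, hsi]
      · rw [eq_single_of_pderiv_eq_C hqb hs hsi, Finsupp.weight_single, one_smul]
    · simpa [Finsupp.weight_single] using weight_le_weightedTotalDegree w hqi
  have hqform : initialForm w q = C b * X i := by
    ext s
    rw [initialForm, hq, coeff_weightedHomogeneousComponent, coeff_C_mul, coeff_X, hweight]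
    by_cases h1 : s = single i 1
    · rw [h1, coeff_single_of_pderiv_eq_C hqb]; simp
    · rw [if_neg (Ne.symm h1), mul_zero, ite_eq_right_iff]
      intro hw
      by_contra hs
      refine h1 (eq_single_of_pderiv_eq_C hqb hs fun h0 => hi ?_)
      rw [← hw, h0, zero_mul]
  set B := Algebra.adjoin k {initialForm w p, initialForm w q}
  have hmp : initialForm w p ∈ B := Algebra.subset_adjoin (by simp)
  have hmq : initialForm w q ∈ B := Algebra.subset_adjoin (by simp)
  have hCB : ∀ r : k, C r ∈ B := fun r => B.algebraMap_mem r
  have hX : ∀ l, (X l : MvPolynomial (Fin 2) k) ∈ B := by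
    intro l
    rcases hij l with rfl | rfl
    · have : (X l : MvPolynomial (Fin 2) k) = C b⁻¹ * initialForm w q := by
        rw [hqform, ← mul_assoc, ← C_mul, inv_mul_cancel₀ hb, C_1, one_mul]
      rw [this]
      exact B.mul_mem (hCB _) hmq
    · have : (X l : MvPolynomial (Fin 2) k) = C a⁻¹ * (initialForm w p - C (coeff 0 p)) := by
        rw [hpform, add_sub_cancel_right, ← mul_assoc, ← C_mul, inv_mul_cancel₀ ha, C_1, one_mul]
      rw [this]
      exact B.mul_mem (hCB _) (B.sub_mem hmp (hCB _))
  rw [eq_top_iff, ← adjoin_range_X]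
  exact Algebra.adjoin_le (Set.range_subset_iff.2 hX)

theorem initialForm_of_weight_eq_zero {w : Fin 2 → ℕ} (h0 : w 0 = 0) (h1 : w 1 = 0)
    (f : MvPolynomial (Fin 2) k) : initialForm w f = f := by
  classical
  have hw : ∀ s : Fin 2 →₀ ℕ, weight w s = 0 := fun s => by simp [weight_fin_two, h0, h1]
  have hd : weightedTotalDegree w f = 0 :=
    Nat.le_zero.1 (weightedTotalDegree_le_iff.2 fun s _ => (hw s).le)
  ext s
  rw [initialForm, coeff_weightedHomogeneousComponent, hw, hd, if_pos rfl]

theorem algebraicIndependent_initialForm_of_degree_eq_zero [CharZero k] {w : Fin 2 → ℕ}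
    {f₁ f₂ : MvPolynomial (Fin 2) k}
    (hgen : Algebra.adjoin k {f₁, f₂} = (⊤ : Subalgebra k (MvPolynomial (Fin 2) k)))
    (hd : weightedTotalDegree w f₁ = 0 ∨ weightedTotalDegree w f₂ = 0) :
    AlgebraicIndependent k ![initialForm w f₁, initialForm w f₂] := by
  apply algebraicIndependent_of_adjoin_eq_top
  obtain ⟨c, hc, hJ⟩ := jacobianDerivation_eq_C hgen
  have hJ' : jacobianDerivation f₂ f₁ = C (-c) := by rw [jacobianDerivation_swap, hJ, C_neg]
  have key : ∀ {p q : MvPolynomial (Fin 2) k} {c : k}, c ≠ 0 → jacobianDerivation p q = C c →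
      weightedTotalDegree w p = 0 → w 0 ≠ 0 ∨ w 1 ≠ 0 →
      Algebra.adjoin k {initialForm w p, initialForm w q} = ⊤ := by
    intro p q c hc hJ hp hw
    rw [jacobianDerivation_apply] at hJ
    rcases hw with hw | hw
    · exact adjoin_initialForm_eq_top_of_degree_eq_zero (i := 0) (j := 1) (by decide) (by decide)
        hw hp hc hJ
    · refine adjoin_initialForm_eq_top_of_degree_eq_zero (i := 1) (j := 0) (by decide) (by decide)
        hw hp (neg_ne_zero.2 hc) ?_
      rw [C_neg, ← hJ, neg_sub]
  by_cases hw : w 0 ≠ 0 ∨ w 1 ≠ 0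
  · rcases hd with hd | hd
    · exact key hc hJ hd hw
    · rw [Set.pair_comm]
      exact key (neg_ne_zero.2 hc) hJ' hd hw
  · push Not at hw
    rwa [initialForm_of_weight_eq_zero hw.1 hw.2, initialForm_of_weight_eq_zero hw.1 hw.2]

/-! ### The inequality and divisibility -/

theorem weightedHomogeneousComponent_X (w : Fin 2 → ℕ) (i : Fin 2) {n : ℕ}
    (h : weightedHomogeneousComponent w n (X i : MvPolynomial (Fin 2) k) ≠ 0) :
    weightedHomogeneousComponent w n (X i : MvPolynomial (Fin 2) k) = X i := by
  have hX := isWeightedHomogeneous_X k w i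
  by_cases hn : n = w i
  · rw [hn, hX.weightedHomogeneousComponent_same]
  · exact absurd (hX.weightedHomogeneousComponent_ne n hn) h

theorem lcm_add_min_le_of_not_algebraicIndependent [CharZero k] {w : Fin 2 → ℕ}
    {f₁ f₂ : MvPolynomial (Fin 2) k}
    (hgen : Algebra.adjoin k {f₁, f₂} = (⊤ : Subalgebra k (MvPolynomial (Fin 2) k)))
    (hd₁ : 0 < weightedTotalDegree w f₁) (hd₂ : 0 < weightedTotalDegree w f₂)
    (hdep : ¬ AlgebraicIndependent k ![initialForm w f₁, initialForm w f₂]) :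
    (weightedTotalDegree w f₁).lcm (weightedTotalDegree w f₂) + min (w 0) (w 1) ≤
      weightedTotalDegree w f₁ + weightedTotalDegree w f₂ := by
  obtain ⟨c, hc, hJ⟩ := jacobianDerivation_eq_C hgen
  by_contra! hlt
  apply hdep
  apply algebraicIndependent_of_adjoin_eq_top
  rw [eq_top_iff, ← adjoin_range_X]
  refine Algebra.adjoin_le (Set.range_subset_iff.2 fun i => ?_)
  obtain ⟨P, hP⟩ := exists_aeval_eq_of_adjoin_eq_top hgen (X i)
  have hP0 : P ≠ 0 := by
    rintro rfl
    exact X_ne_zero i (by rw [← hP, map_zero])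
  obtain ⟨m, h1, h2, h3⟩ := exists_degree_bound w hd₁ hd₂ hc hJ hP0 rfl
  rw [hP] at h2 h3
  have hXd : weightedTotalDegree w (X i : MvPolynomial (Fin 2) k) = w i :=
    WithBot.coe_injective ((weightedTotalDegree_coe w _ (X_ne_zero i)).symm.trans
      ((isWeightedHomogeneous_X k w i).weighted_total_degree (X_ne_zero i)))
  rw [hXd] at h2
  -- For m ≥ 1, d₁ + d₂ < lcm + min and w₁ + w₂ = min + max turn the bound into m lcm ≤ max + m(lcm
  -- - 1 - max) < m lcm.
  have hm : m = 0 := by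
    by_contra hm
    have hmax : w i ≤ max (w 0) (w 1) := by fin_cases i <;> simp
    have h4 := Nat.mul_le_mul_left m hlt
    have h5 : max (w 0) (w 1) ≤ m * max (w 0) (w 1) := Nat.le_mul_of_pos_left _ (by omega)
    have h6 := congrArg (m * ·) (min_add_max (w 0) (w 1))
    simp only [Nat.succ_eq_add_one, mul_add] at h2 h4 h6
    omega
  obtain ⟨hne, hmem⟩ := h3 hm
  rwa [weightedHomogeneousComponent_X w i hne] at hmem

theorem dvd_or_dvd_of_lcm_le_add {a b : ℕ} (ha : 0 < a) (hb : 0 < b) (h : a.lcm b ≤ a + b) :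
    a ∣ b ∨ b ∣ a := by
  by_contra! hn
  obtain ⟨x, hx⟩ := Nat.dvd_lcm_left a b
  -- Without divisibility both cofactors are at least 2, so 2a and 2b are at most lcm ≤ a + b,
  -- forcing a = b.
  obtain ⟨y, hy⟩ := Nat.dvd_lcm_right a b
  have hl : 0 < a.lcm b := Nat.lcm_pos ha hb
  have hx2 : 2 ≤ x := by
    rcases x with _ | _ | x
    · omega
    · exact absurd (hx ▸ Nat.dvd_lcm_right a b) (by simpa using hn.2)
    · omega
  have hy2 : 2 ≤ y := by
    rcases y with _ | _ | y
    · omega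
    · exact absurd (hy ▸ Nat.dvd_lcm_left a b) (by simpa using hn.1)
    · omega
  have h1 := Nat.mul_le_mul_left a hx2
  have h2 := Nat.mul_le_mul_left b hy2
  have : a = b := by omega
  exact hn.1 (this ▸ dvd_rfl)

end InitialForms

theorem mainTheorem5 {k : Type*} [Field k] [CharZero k]
    (f₁ f₂ : MvPolynomial (Fin 2) k)
    (hgen : Algebra.adjoin k {f₁, f₂} = (⊤ : Subalgebra k (MvPolynomial (Fin 2) k)))
    (w : Fin 2 → ℕ)
    (hdep : ¬ AlgebraicIndependent k ![initialForm w f₁, initialForm w f₂]) :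
    (0 < weightedTotalDegree w f₁ ∧ 0 < weightedTotalDegree w f₂ ∧
      Nat.lcm (weightedTotalDegree w f₁) (weightedTotalDegree w f₂) + min (w 0) (w 1) ≤
        weightedTotalDegree w f₁ + weightedTotalDegree w f₂) ∧
    (weightedTotalDegree w f₁ ∣ weightedTotalDegree w f₂ ∨
      weightedTotalDegree w f₂ ∣ weightedTotalDegree w f₁) := by
  have hd₁ : 0 < weightedTotalDegree w f₁ := Nat.pos_of_ne_zero fun h =>
    hdep (algebraicIndependent_initialForm_of_degree_eq_zero hgen (Or.inl h))
  have hd₂ : 0 < weightedTotalDegree w f₂ := Nat.pos_of_ne_zero fun h =>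
    hdep (algebraicIndependent_initialForm_of_degree_eq_zero hgen (Or.inr h))
  have h := lcm_add_min_le_of_not_algebraicIndependent hgen hd₁ hd₂ hdep
  exact ⟨⟨hd₁, hd₂, h⟩, dvd_or_dvd_of_lcm_le_add hd₁ hd₂ ((Nat.le_add_right _ _).trans h)⟩
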